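/- **Setting.** Let $\mathcal P=\mathbb R[k,k',k'',\dots]$ be the algebra of differential polynomials with total derivative $\partial=D_s$ ($\partial k^{(m)}=k^{(m+1)}$), let $\mathcal P_0\subset\mathcal P$ be the polynomials without constant term, and write $\int f\,ds$ for the class of $f$ in $\mathcal P/\operatorname{Im}\partial$. For $f\in\operatorname{Im}\partial$ let $D_s^{-1}f$ be the unique antiderivative of $f$ in $\mathcal P_0$. For $a\in\mathcal P$ let $\partial_a=\sum_m a^{(m)}\,\partial/\partial k^{(m)}$; these derivations form a Lie algebra $\mathrm{der}^*(\mathcal P)$. On covectors $\alpha_p(\partial_a)=\int ap\,ds$ with $kp'\in\operatorname{Im}\partial$ let $$\pi_1(\alpha_p)=\partial_{\mathcal D p},\qquad \mathcal D=D_s^3+k_sD_s^{-1}kD_s+k^2D_s .$$ Let $I\subset\mathbb R$ be a nondegenerate interval and $\Lambda_0$ the set of smooth arc-length parametrized curves $\gamma:I\to\mathbb R^2$, with unit tangent $T$, unit normal $N$ ($T$ rotated by $\pi/2$) and signed curvature $k_\gamma$, so $T'=k_\gamma N$, $N'=-k_\gamma T$. Let $T_{\mathcal P,\gamma}$ be the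 space of $v=fT+gN$ with $f,g\in\mathcal P$ and $f=D_s^{-1}(kg)\in\mathcal P_0$ (locally arc-length preserving fields along $\gamma$). Such $v$ acts on $\mathcal P$ as the derivation $\partial_{v(k)}$, where $v(k)=\varphi_v'$ and $\varphi_v=g'+kf$, and on $\mathcal P/\operatorname{Im}\partial$ by $v\int L\,ds=\int v(L)\,ds$. The bracket is $[v,w]=D_vw-D_wv$ with $$D_vw=(v(f_w)-g_w\varphi_v)T+(v(g_w)+f_w\varphi_v)N .$$ Put $\Phi_\gamma(v)=\partial_{v(k)}\in\mathrm{der}^*(\mathcal P)$. Let $\mathcal A$ be the algebra of all maps $\Lambda_0\to\mathcal P$, $\mathfrak X_{\mathcal A}(\Lambda_0)$ the Lie algebra of all $V$ with $V_\gamma\in T_{\mathcal P,\gamma}$ for each $\gamma$ (bracket taken at each $\gamma$), and $\Omega^0$ the $\mathfrak X_{\mathcal A}(\Lambda_0)$-module of functionals $S=\int L\,ds$, $L\in\mathcal A$, that is $S(\gamma)=\int L_\gamma\,ds\in\mathcal P/\operatorname{Im}\partial$, with $(VS)(\gamma)=V_\gamma(S(\gamma))$ and $dS(V)=VS$. Let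 $\Omega^1$ be the space of covectors $\alpha_p:\mathfrak X_{\mathcal A}(\Lambda_0)\to\Omega^0$, $\alpha_p(V)=\int V(k)\,p\,ds$, with $p\in\mathcal A$ such that $p_1'=kp'$ for some $p_1\in\mathcal A$. A *Hamiltonian operator* is a linear map $\pi:\Omega^1\to\mathfrak X_{\mathcal A}(\Lambda_0)$ which is skew ($\langle\pi\alpha,\beta\rangle=-\langle\pi\beta,\alpha\rangle$), whose image is a Lie subalgebra, and for which $\omega(\pi\alpha,\pi\beta)=\langle\pi\alpha,\beta\rangle$ is closed: $(\pi\alpha)\,\omega(\pi\beta,\pi\gamma)-\omega([\pi\alpha,\pi\beta],\pi\gamma)+\text{cyclic permutations}=0$. **Theorem.** 1. $\Phi_\gamma$ is injective, and $\Omega^1$ is an admissible space of one-forms: each nonzero $\alpha\in\Omega^1$ is nonzero on some vector field, for each nonzero vector field $V$ there is $\alpha\in\Omega^1$ with $\alpha(V)\neq0$, and $dS\in\Omega^1$ for every $S\in\Omega^0$. 2. There is exactly one map $\bar\pi:\Omega^1\to\mathfrak X_{\mathcal A}(\Lambda_0)$ with $\bar\pi(\alpha_p)(\gamma)=\Phi_\gamma^{-1}\,\pi_1(\alpha_{p_\gamma})$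 for all $\alpha_p\in\Omega^1$, $\gamma\in\Lambda_0$, and it is a Hamiltonian operator. 3. Explicitly, $\bar\pi(\alpha_p)(\gamma)=D_s^{-1}(k\,p_\gamma')\,T+p_\gamma'\,N$. 4. For $S_0=\int\frac12k^2\,ds$ the Hamiltonian vector field is $\bar\pi(dS_0)(\gamma)=\frac12k^2\,T+k'\,N$. Hence a family $\gamma(\cdot,t)\in\Lambda_0$ satisfies the Hamiltonian equation $\gamma_t=\bar\pi(dS_0)(\gamma)$ if and only if it satisfies the planar filament equation $\gamma_t=\frac12k_\gamma^2\,T+k_\gamma'\,N$. -/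

import Mathlib

open MvPolynomial
open scoped ContDiff

noncomputable section
namespace PlanarFilament

/-- The algebra `𝒫 = ℝ[k, k', k'', …]` of differential polynomials; `X m` stands for `k^{(m)}`. -/
abbrev DiffPoly : Type := MvPolynomial ℕ ℝ

/-- The generator `k`. -/
def kappa : DiffPoly := X 0

/-- The total derivative `∂ = D_s`, the derivation with `∂ k^{(m)} = k^{(m+1)}`. -/
def totalD : Derivation ℝ DiffPoly DiffPoly := mkDerivation ℝ fun m => X (m + 1)

/-- The derivation `∂_a = ∑ₘ a^{(m)} ∂/∂k^{(m)}`. -/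
def evol (a : DiffPoly) : Derivation ℝ DiffPoly DiffPoly :=
  mkDerivation ℝ fun m => totalD^[m] a

theorem evol_kappa (a : DiffPoly) : evol a kappa = a := by
  simp [evol, kappa, mkDerivation_X]

theorem evol_totalD (a f : DiffPoly) : evol a (totalD f) = totalD (evol a f) := by
  have h : ⁅evol a, totalD⁆ = 0 := by
    apply derivation_ext
    intro m
    simp [Derivation.commutator_apply, evol, totalD, mkDerivation_X, Function.iterate_succ_apply']
  have h2 := congrArg (fun D => D f) h
  simpa [Derivation.commutator_apply, sub_eq_zero] using h2

theorem evol_iterate (a f : DiffPoly) (m : ℕ) :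
    evol a (totalD^[m] f) = totalD^[m] (evol a f) := by
  induction m with
  | zero => rfl
  | succ m ih => rw [Function.iterate_succ_apply', Function.iterate_succ_apply', evol_totalD, ih]

theorem evol_X (a : DiffPoly) (m : ℕ) : evol a (X m) = totalD^[m] a := by
  simp [evol, mkDerivation_X]

theorem iterate_add (a b : DiffPoly) (m : ℕ) :
    totalD^[m] (a + b) = totalD^[m] a + totalD^[m] b := by
  induction m with
  | zero => rfl
  | succ m ih => simp only [Function.iterate_succ_apply', ih, map_add]

theorem iterate_smul (c : ℝ) (a : DiffPoly) (m : ℕ) :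
    totalD^[m] (c • a) = c • totalD^[m] a := by
  induction m with
  | zero => rfl
  | succ m ih => simp only [Function.iterate_succ_apply', ih, Derivation.map_smul]

/-- `a ↦ ∂_a` as a linear map. -/
def evolₗ : DiffPoly →ₗ[ℝ] Derivation ℝ DiffPoly DiffPoly where
  toFun := evol
  map_add' a b := derivation_ext fun m => by
    simp only [Derivation.add_apply, evol_X, iterate_add]
  map_smul' c a := derivation_ext fun m => by
    simp only [RingHom.id_apply, Derivation.smul_apply, evol_X, iterate_smul]

theorem lie_evol (a b : DiffPoly) : ⁅evol a, evol b⁆ = evol (evol a b - evol b a) := by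
  apply derivation_ext
  intro m
  have h : evol (evol a b - evol b a) = evol (evol a b) - evol (evol b a) :=
    map_sub evolₗ _ _
  simp only [Derivation.commutator_apply, h, Derivation.sub_apply, evol_X, evol_iterate]

/-- The Lie algebra `der*(𝒫)` of derivation vector fields `∂_a`, with the commutator. -/
def derStar : LieSubalgebra ℝ (Derivation ℝ DiffPoly DiffPoly) where
  toSubmodule := LinearMap.range evolₗ
  lie_mem' := by
    rintro _ _ ⟨a, rfl⟩ ⟨b, rfl⟩
    exact ⟨evol a b - evol b a, (lie_evol a b).symm⟩

/-- `a ↦ ∂_a`, with values in `der*(𝒫)`. -/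
def partialD : DiffPoly →ₗ[ℝ] derStar := evolₗ.rangeRestrict

theorem partialD_apply (a f : DiffPoly) :
    (partialD a : Derivation ℝ DiffPoly DiffPoly) f = evol a f := rfl

/-- The total derivatives `Im ∂`. -/
abbrev totalDerivs : Submodule ℝ DiffPoly := LinearMap.range (totalD : DiffPoly →ₗ[ℝ] DiffPoly)

/-- The functionals `𝒫 / Im ∂`. -/
abbrev Pbar : Type := DiffPoly ⧸ totalDerivs

/-- The projection `f ↦ ∫ f ds` from `𝒫` to `𝒫 / Im ∂`. -/
abbrev integral : DiffPoly →ₗ[ℝ] Pbar := totalDerivs.mkQ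

open Classical in
/-- The formal antiderivative `D_s⁻¹ f` with zero constant term. It is unique when it exists
(the kernel of `∂` is `ℝ`); the value `0` for non-exact `f` is a convention that is never used. -/
def Dinv (f : DiffPoly) : DiffPoly :=
  if h : ∃ q : DiffPoly, totalD q = f ∧ constantCoeff q = 0 then h.choose else 0

/-- `𝒟 = D_s³ + k_s D_s⁻¹ k D_s + k² D_s`. -/
def opD (p : DiffPoly) : DiffPoly :=
  totalD (totalD (totalD p)) + totalD kappa * Dinv (kappa * totalD p) + kappa ^ 2 * totalD p

/-- The domain of `𝒟` in `𝒫`: those `p` for which `k p'` is a total derivative. -/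
def domD : Submodule ℝ DiffPoly :=
  totalDerivs.comap (LinearMap.mulLeft ℝ kappa ∘ₗ (totalD : DiffPoly →ₗ[ℝ] DiffPoly))

/-- The covector field `α_p` on `der*(𝒫)`, `α_p(∂_a) = ∫ a p ds` (note `a = ∂_a k`). -/
def mkdvCovector : DiffPoly →ₗ[ℝ] (derStar →ₗ[ℝ] Pbar) :=
  LinearMap.mk₂ ℝ (fun p ξ => integral ((ξ : Derivation ℝ DiffPoly DiffPoly) kappa * p))
    (fun p q ξ => by rw [mul_add, map_add])
    (fun c p ξ => by rw [mul_smul_comm, map_smul])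
    (fun p ξ η => by rw [← map_add, ← add_mul]; rfl)
    (fun c p ξ => by rw [← map_smul, ← smul_mul_assoc]; rfl)

theorem mkdvCovector_partialD (p a : DiffPoly) :
    mkdvCovector p (partialD a) = integral (a * p) := by
  change integral (evol a kappa * p) = _
  rw [evol_kappa]

/-! The one-form `α_p` determines `p`. -/

theorem notMem_vars_of_pderiv_eq_zero {N : ℕ} {r : DiffPoly} (h : pderiv N r = 0) :
    N ∉ r.vars := by
  intro hN
  obtain ⟨m, hm, hmN⟩ := (mem_vars_iff_mem_support N).1 hN
  have hc := coeff_pderiv (i := N) r (m - Finsupp.single N 1)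
  have h1 : m N ≠ 0 := by simpa using hmN
  have h2 : m - Finsupp.single N 1 + Finsupp.single N 1 = m := by
    ext j
    by_cases hj : j = N
    · subst hj; simp; omega
    · simp [Ne.symm hj]
  rw [h, h2] at hc
  simp only [coeff_zero] at hc
  rcases mul_eq_zero.1 hc.symm with h3 | h3
  · exact (mem_support_iff.1 hm) h3
  · norm_cast at h3

theorem degreeOf_eq_zero_iff_vars (N : ℕ) (q : DiffPoly) : degreeOf N q = 0 ↔ N ∉ q.vars := by
  classical
  simp [degreeOf, vars, Multiset.count_eq_zero]

theorem derivation_mem_supported {s : Set ℕ} {f : ℕ → DiffPoly}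
    (hf : ∀ m ∈ s, f m ∈ supported ℝ s) {r : DiffPoly} (hr : r ∈ supported ℝ s) :
    mkDerivation ℝ f r ∈ supported ℝ s := by
  induction hr using Algebra.adjoin_induction with
  | mem x hx =>
    obtain ⟨m, hm, rfl⟩ := hx
    rw [mkDerivation_X]
    exact hf m hm
  | algebraMap c => rw [Derivation.map_algebraMap]; exact Subalgebra.zero_mem _
  | add x y _ _ hx hy => rw [map_add]; exact Subalgebra.add_mem _ hx hy
  | mul x y hx' hy' hx hy =>
    rw [Derivation.leibniz]
    exact Subalgebra.add_mem _ (Subalgebra.mul_mem _ hx' hy) (Subalgebra.mul_mem _ hy' hx)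

theorem totalD_split {N : ℕ} {r : DiffPoly} (hr : r ∈ supported ℝ (Set.Iic N)) :
    ∃ A ∈ supported ℝ (Set.Iic N), totalD r = A + X (N + 1) * pderiv N r := by
  refine ⟨mkDerivation ℝ (fun m => if m < N then X (m + 1) else (0 : DiffPoly)) r,
    derivation_mem_supported (fun m _ => ?_) hr, ?_⟩
  · split_ifs with h
    · exact Algebra.subset_adjoin ⟨m + 1, by simpa using h, rfl⟩
    · exact Subalgebra.zero_mem _
  · have := derivation_eqOn_supported (R := ℝ) (D₁ := totalD)
      (D₂ := mkDerivation ℝ (fun m => if m < N then X (m + 1) else (0 : DiffPoly)) +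
        (X (N + 1) : DiffPoly) • pderiv N) (s := Set.Iic N) (fun m hm => ?_) hr
    · simpa using this
    · rcases lt_or_eq_of_le (Set.mem_Iic.1 hm) with h | h
      · simp [totalD, mkDerivation_X, h, h.ne]
      · simp [totalD, mkDerivation_X, h]

theorem eq_zero_of_sq_exact (p : DiffPoly) (h : p * p ∈ totalDerivs) : p = 0 := by
  obtain ⟨r, hr⟩ := h
  change totalD r = p * p at hr
  have key : ∀ N, r ∈ supported ℝ (Set.Iio N) → p = 0 := by
    intro N
    induction N with
    | zero =>
      intro h
      have h0 : totalD r = 0 := by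
        have := derivation_eqOn_supported (R := ℝ) (D₁ := totalD) (D₂ := 0)
          (s := Set.Iio 0) (fun m hm => absurd hm (Nat.not_lt_zero m)) h
        simpa using this
      rw [h0] at hr
      exact mul_self_eq_zero.1 hr.symm
    | succ N ih =>
      intro h
      by_contra hp
      have hI : (Set.Iio (N + 1) : Set ℕ) = Set.Iic N := by ext; simp
      rw [hI] at h
      obtain ⟨A, hA, hAr⟩ := totalD_split h
      have hz : ∀ q ∈ supported ℝ (Set.Iic N), degreeOf (N + 1) q = 0 := by
        intro q hq
        rw [mem_supported] at hq
        rw [degreeOf_eq_zero_iff_vars]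
        intro hm
        have := hq hm
        simp at this
      have hB : pderiv N r ∈ supported ℝ (Set.Iic N) := by
        classical
        rw [pderiv_def]
        refine derivation_mem_supported (fun m _ => ?_) h
        by_cases hm : m = N
        · subst hm; simp
        · simp [hm]
      have hd : degreeOf (N + 1) (p * p) ≤ 1 := by
        rw [← hr, hAr]
        refine (degreeOf_add_le _ _ _).trans (max_le (by rw [hz A hA]; omega) ?_)
        refine (degreeOf_mul_le _ _ _).trans ?_
        rw [hz _ hB, degreeOf_X]
        simp
      rw [degreeOf_mul_eq hp hp] at hd
      have hp0 : pderiv (N + 1) p = 0 := by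
        apply pderiv_eq_zero_of_notMem_vars
        rw [← degreeOf_eq_zero_iff_vars]
        omega
      have hv : ∀ q ∈ supported ℝ (Set.Iic N), pderiv (N + 1) q = 0 := fun q hq => by
        apply pderiv_eq_zero_of_notMem_vars
        rw [← degreeOf_eq_zero_iff_vars, hz q hq]
      have h1 : pderiv (N + 1) (totalD r) = pderiv N r := by
        rw [hAr, map_add, hv A hA, Derivation.leibniz, hv _ hB]
        simp
      have h2 : pderiv N r = 0 := by
        rw [← h1, hr, Derivation.leibniz, hp0]; simp
      refine hp (ih ?_)
      rw [mem_supported] at h ⊢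
      intro m hm
      have h3 := notMem_vars_of_pderiv_eq_zero h2
      have h4 : m ≤ N := h hm
      have h5 : m ≠ N := fun e => h3 (e ▸ hm)
      exact lt_of_le_of_ne h4 h5
  obtain ⟨N, hN⟩ := r.vars.bddAbove
  refine key (N + 1) ?_
  rw [mem_supported]
  intro m hm
  exact Nat.lt_succ_of_le (hN hm)

theorem mkdvCovector_injective : Function.Injective mkdvCovector := by
  rw [injective_iff_map_eq_zero]
  intro p hp
  apply eq_zero_of_sq_exact
  have := congrArg (fun α => α (partialD p)) hp
  simp only [mkdvCovector_partialD, LinearMap.zero_apply] at this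
  exact (Submodule.Quotient.mk_eq_zero _).1 this




/-- The one-forms on `der*(𝒫)` on which `π₁` is defined. -/
def mkdvOneForms : Submodule ℝ (derStar →ₗ[ℝ] Pbar) := domD.map mkdvCovector

def mkdvForm (p : DiffPoly) (hp : p ∈ domD) : mkdvOneForms :=
  ⟨mkdvCovector p, Submodule.mem_map_of_mem hp⟩

/-- The second mKdV Hamiltonian operator: `π₁(α_p) = ∂_{𝒟 p}`, see `pi1_mkdvForm`. -/
def pi1 (α : mkdvOneForms) : derStar :=
  partialD (opD (Submodule.mem_map.1 α.2).choose)

theorem pi1_mkdvForm (p : DiffPoly) (hp : p ∈ domD) :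
    pi1 (mkdvForm p hp) = partialD (opD p) := by
  have h := (Submodule.mem_map.1 (mkdvForm p hp).2).choose_spec.2
  rw [pi1, mkdvCovector_injective h]

/-- Pairs `(f, g)` with `f' = k g` and `f` without constant term, i.e. `f = D_s⁻¹(k g) ∈ 𝒫₀`. -/
def tangentSubmodule : Submodule ℝ (DiffPoly × DiffPoly) where
  carrier := {v | totalD v.1 = kappa * v.2 ∧ constantCoeff v.1 = 0}
  zero_mem' := by simp
  add_mem' := by
    rintro v w ⟨hv, hv0⟩ ⟨hw, hw0⟩
    exact ⟨by simp [hv, hw, mul_add], by simp [hv0, hw0]⟩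
  smul_mem' := by
    rintro c v ⟨hv, hv0⟩
    exact ⟨by simp [hv], by simp [hv0]⟩

/-- The space `T_{𝒫,γ}(Λ₀)` of vector fields `f T + g N` along a plane curve `γ`, with components in
`𝒫`, that preserve arc length locally. It is given by the components in the Frenet frame. -/
def Tangent : Type := tangentSubmodule

namespace Tangent

instance : AddCommGroup Tangent := inferInstanceAs (AddCommGroup tangentSubmodule)
instance : Module ℝ Tangent := inferInstanceAs (Module ℝ tangentSubmodule)

/-- The tangential component `f`. -/
def tan : Tangent →ₗ[ℝ] DiffPoly := LinearMap.fst ℝ _ _ ∘ₗ tangentSubmodule.subtype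

/-- The normal component `g`. -/
def nor : Tangent →ₗ[ℝ] DiffPoly := LinearMap.snd ℝ _ _ ∘ₗ tangentSubmodule.subtype

@[ext]
theorem ext {v w : Tangent} (h1 : v.tan = w.tan) (h2 : v.nor = w.nor) : v = w :=
  Subtype.ext (Prod.ext h1 h2)

theorem totalD_tan (v : Tangent) : totalD v.tan = kappa * v.nor := v.2.1

theorem constantCoeff_tan (v : Tangent) : constantCoeff v.tan = 0 := v.2.2

/-- `φ_v = ⟨∇_T v, N⟩ = g' + k f`. -/
def phi : Tangent →ₗ[ℝ] DiffPoly :=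
  (totalD : DiffPoly →ₗ[ℝ] DiffPoly) ∘ₗ nor + LinearMap.mulLeft ℝ kappa ∘ₗ tan

theorem phi_apply (v : Tangent) : phi v = totalD v.nor + kappa * v.tan := rfl

/-- `v(k) = φ_v'`, the variation of the curvature (here `ρ_v = f' - k g = 0`). -/
def curv : Tangent →ₗ[ℝ] DiffPoly := (totalD : DiffPoly →ₗ[ℝ] DiffPoly) ∘ₗ phi

theorem curv_apply (v : Tangent) : curv v = totalD (phi v) := rfl

/-- A tangent field acts on `𝒫` as the derivation commuting with `∂` that sends `k` to `v(k)`. -/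
def der (v : Tangent) : Derivation ℝ DiffPoly DiffPoly := evol v.curv

theorem der_totalD (v : Tangent) (f : DiffPoly) : der v (totalD f) = totalD (der v f) :=
  evol_totalD _ _

theorem der_kappa (v : Tangent) : der v kappa = totalD v.phi := evol_kappa _

theorem der_add (v w : Tangent) (f : DiffPoly) : der (v + w) f = der v f + der w f := by
  have : evolₗ (curv (v + w)) = evolₗ (curv v) + evolₗ (curv w) := by rw [map_add, map_add]
  exact congrArg (fun D => D f) this

theorem der_smul (c : ℝ) (v : Tangent) (f : DiffPoly) : der (c • v) f = c • der v f := by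
  have : evolₗ (curv (c • v)) = c • evolₗ (curv v) := by rw [map_smul, map_smul]
  exact congrArg (fun D => D f) this

/-- The components of `D_v w`, where `D_v T = φ_v N` and `D_v N = -φ_v T`. -/
def cov (v w : Tangent) : DiffPoly × DiffPoly :=
  (der v w.tan - w.nor * v.phi, der v w.nor + w.tan * v.phi)

theorem constantCoeff_totalD (f : DiffPoly) : constantCoeff (totalD f) = 0 := by
  induction f using MvPolynomial.induction_on with
  | C a => simp [totalD]
  | add p q hp hq => simp [hp, hq]
  | mul_X p n hp => simp [totalD, mkDerivation_X]

theorem constantCoeff_der (v : Tangent) (f : DiffPoly) : constantCoeff (der v f) = 0 := by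
  induction f using MvPolynomial.induction_on with
  | C a => simp [der, evol]
  | add p q hp hq => simp [hp, hq]
  | mul_X p n hp =>
    simp [der, evol_X, curv_apply, ← Function.iterate_succ_apply,
      Function.iterate_succ_apply', constantCoeff_totalD]

theorem constantCoeff_phi (v : Tangent) : constantCoeff (phi v) = 0 := by
  simp [phi_apply, constantCoeff_totalD, kappa]

theorem cov_sub_mem (v w : Tangent) : cov v w - cov w v ∈ tangentSubmodule := by
  constructor
  · simp only [cov, Prod.fst_sub, Prod.snd_sub, map_sub, Derivation.leibniz, smul_eq_mul,
      ← der_totalD, totalD_tan, der_kappa]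
    rw [phi_apply v, phi_apply w]
    simp only [map_add, Derivation.leibniz, smul_eq_mul, totalD_tan]
    ring
  · simp [cov, constantCoeff_der, constantCoeff_phi]

/-- `[v, w] = D_v w - D_w v`. -/
instance : Bracket Tangent Tangent := ⟨fun v w => ⟨cov v w - cov w v, cov_sub_mem v w⟩⟩

theorem lie_tan (v w : Tangent) :
    tan ⁅v, w⁆ = der v w.tan - w.nor * v.phi - (der w v.tan - v.nor * w.phi) := rfl

theorem lie_nor (v w : Tangent) :
    nor ⁅v, w⁆ = der v w.nor + w.tan * v.phi - (der w v.nor + v.tan * w.phi) := rfl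

theorem phi_lie (v w : Tangent) : phi ⁅v, w⁆ = der v w.phi - der w v.phi := by
  rw [phi_apply, lie_tan, lie_nor]
  simp only [map_add, map_sub, Derivation.leibniz, smul_eq_mul, ← der_totalD, totalD_tan]
  have h : ∀ u z : Tangent, der u z.phi =
      der u (totalD z.nor) + (kappa * der u z.tan + z.tan * totalD u.phi) := by
    intro u z
    conv_lhs => rw [phi_apply]
    rw [map_add, Derivation.leibniz, smul_eq_mul, smul_eq_mul, der_kappa]
  rw [h, h]
  ring

theorem curv_lie (v w : Tangent) : curv ⁅v, w⁆ = der v w.curv - der w v.curv := by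
  rw [curv_apply, phi_lie, map_sub, ← der_totalD, ← der_totalD, curv_apply, curv_apply]

theorem der_lie (v w : Tangent) (f : DiffPoly) :
    der ⁅v, w⁆ f = der v (der w f) - der w (der v f) := by
  have h : der ⁅v, w⁆ = ⁅der v, der w⁆ := by
    rw [der, curv_lie, der, der, lie_evol]
  rw [h, Derivation.commutator_apply]

instance : LieRing Tangent where
  add_lie u v w := by
    ext1 <;> simp only [lie_tan, lie_nor, map_add, der_add] <;> ring
  lie_add u v w := by
    ext1 <;> simp only [lie_tan, lie_nor, map_add, der_add] <;> ring
  lie_self v := by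
    ext1 <;> simp only [lie_tan, lie_nor, map_zero] <;> ring
  leibniz_lie u v w := by
    ext1 <;> simp only [lie_tan, lie_nor, map_add, map_sub, der_lie, phi_lie,
      Derivation.leibniz, smul_eq_mul] <;> ring

instance : LieAlgebra ℝ Tangent where
  lie_smul c v w := by
    ext1 <;> simp only [lie_tan, lie_nor, map_smul, der_smul, smul_mul_assoc, mul_smul_comm,
      smul_sub, smul_add, Derivation.map_smul]

/-- The action of a tangent field on functionals, `v ∫ L ds = ∫ v(L) ds`. -/
def act (v : Tangent) : Pbar →ₗ[ℝ] Pbar :=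
  totalDerivs.mapQ totalDerivs (der v : DiffPoly →ₗ[ℝ] DiffPoly) (by
    rintro _ ⟨f, rfl⟩
    exact ⟨der v f, (der_totalD v f).symm⟩)

theorem act_integral (v : Tangent) (L : DiffPoly) : act v (integral L) = integral (der v L) :=
  rfl

instance : LieRingModule Tangent Pbar where
  bracket v F := act v F
  add_lie v w F := by
    obtain ⟨L, rfl⟩ := totalDerivs.mkQ_surjective F
    change act _ _ = act _ _ + act _ _
    rw [act_integral, act_integral, act_integral, der_add, map_add]
  lie_add v F G := map_add (act v) F G
  leibniz_lie v w F := by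
    obtain ⟨L, rfl⟩ := totalDerivs.mkQ_surjective F
    change act _ (act _ _) = act _ _ + act _ (act _ _)
    simp only [act_integral, der_lie, map_sub]
    abel

instance : LieModule ℝ Tangent Pbar where
  smul_lie c v F := by
    obtain ⟨L, rfl⟩ := totalDerivs.mkQ_surjective F
    change act _ _ = c • act _ _
    rw [act_integral, act_integral, der_smul, map_smul]
  lie_smul c v F := map_smul (act v) c F

end Tangent

/-- The map `Φ_γ : T_{𝒫,γ}(Λ₀) → der*(𝒫)`, `v ↦ ∂_{v(k)}`. -/
def Phi : Tangent →ₗ[ℝ] derStar := partialD ∘ₗ Tangent.curv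

/-! ### Hamiltonian operators over a Lie algebra `V` acting on a module `M` of functionals -/

section Hamiltonian

variable {V M : Type*} [LieRing V] [LieAlgebra ℝ V] [AddCommGroup M] [Module ℝ M]
  [LieRingModule V M] [LieModule ℝ V M]

/-- The differential of a functional, `dF(ξ) = ξ F`. -/
def differential (F : M) : V →ₗ[ℝ] M where
  toFun ξ := ⁅ξ, F⁆
  map_add' ξ η := add_lie ξ η F
  map_smul' c ξ := smul_lie c ξ F

/-- The conditions on a space of one-forms. -/
structure IsOneFormSpace (Ω1 : Submodule ℝ (V →ₗ[ℝ] M)) : Prop where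
  exists_vector : ∀ α ∈ Ω1, α ≠ 0 → ∃ ξ : V, α ξ ≠ 0
  exists_form : ∀ ξ : V, ξ ≠ 0 → ∃ α ∈ Ω1, α ξ ≠ 0
  differential_mem : ∀ F : M, differential F ∈ Ω1

/-- A Hamiltonian operator `π : Ω¹ → V`: a skew-symmetric linear map whose image is a Lie subalgebra
and for which the form `ω(πα, πβ) = ⟨πα, β⟩` on the image is closed, where
`dω(πα, πβ, πγ) = (πα) ω(πβ, πγ) - ω([πα, πβ], πγ) + cyclic permutations`. -/
structure IsHamiltonianOperator (Ω1 : Submodule ℝ (V →ₗ[ℝ] M)) (π : Ω1 →ₗ[ℝ] V) : Prop where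
  skew : ∀ α β : Ω1, β.1 (π α) = -α.1 (π β)
  range_lie : ∀ α β : Ω1, ⁅π α, π β⁆ ∈ LinearMap.range π
  closed : ∀ α β γ : Ω1,
    (⁅π α, γ.1 (π β)⁆ - γ.1 ⁅π α, π β⁆) + (⁅π β, α.1 (π γ)⁆ - α.1 ⁅π β, π γ⁆)
      + (⁅π γ, β.1 (π α)⁆ - β.1 ⁅π γ, π α⁆) = 0

end Hamiltonian

/-! ### Plane curves -/

/-- A smooth plane curve on `I` parametrized by arc length. It is a function on `I`; outside `I` the
value is fixed to be `0`. -/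
structure Curve (I : Set ℝ) where
  toFun : ℝ → EuclideanSpace ℝ (Fin 2)
  contDiffOn : ContDiffOn ℝ ∞ toFun I
  unit_speed : ∀ s ∈ I, ‖derivWithin toFun I s‖ = 1
  eq_zero : ∀ s ∉ I, toFun s = 0

namespace Curve

variable {I : Set ℝ}

/-- The unit tangent `T = γ'`. -/
def T (γ : Curve I) (s : ℝ) : EuclideanSpace ℝ (Fin 2) := derivWithin γ.toFun I s

/-- The unit normal `N`, obtained from `T` by a rotation through `π/2`. -/
def N (γ : Curve I) (s : ℝ) : EuclideanSpace ℝ (Fin 2) := !₂[-(γ.T s 1), γ.T s 0]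

/-- The (signed) curvature, `T' = k N`. -/
def k (γ : Curve I) (s : ℝ) : ℝ := inner ℝ (derivWithin γ.T I s) (γ.N s)

/-- The function of `s` given by a differential polynomial in the curvature of `γ`. -/
def evalPoly (γ : Curve I) (p : DiffPoly) (s : ℝ) : ℝ :=
  eval (fun m => iteratedDerivWithin m γ.k I s) p

end Curve

/-- The algebra `𝒜` of `𝒫`-valued scalar fields on the space `Λ₀` of curves. -/
abbrev ScalarField (I : Set ℝ) : Type := Curve I → DiffPoly

/-- The vector fields `𝔛_𝒜(Λ₀)`: `V_γ ∈ T_{𝒫,γ}(Λ₀)` for every curve `γ`. -/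
def VectorField (I : Set ℝ) : Type := Curve I → Tangent

/-- The functionals `S = ∫ L ds` with `L ∈ 𝒜`, as functions `γ ↦ S(γ) = ∫ L_γ ds ∈ 𝒫 / Im ∂`. -/
def Functional (I : Set ℝ) : Type := Curve I → Pbar

section Fields

variable {I : Set ℝ}

instance : AddCommGroup (VectorField I) := inferInstanceAs (AddCommGroup (Curve I → Tangent))
instance : Module ℝ (VectorField I) := inferInstanceAs (Module ℝ (Curve I → Tangent))
instance : AddCommGroup (Functional I) := inferInstanceAs (AddCommGroup (Curve I → Pbar))
instance : Module ℝ (Functional I) := inferInstanceAs (Module ℝ (Curve I → Pbar))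

/-- `[V, W](γ) = [V_γ, W_γ]`. -/
instance : Bracket (VectorField I) (VectorField I) := ⟨fun V W γ => ⁅V γ, W γ⁆⟩

instance : LieRing (VectorField I) where
  add_lie U V W := funext fun γ => add_lie (U γ) (V γ) (W γ)
  lie_add U V W := funext fun γ => lie_add (U γ) (V γ) (W γ)
  lie_self V := funext fun γ => lie_self (V γ)
  leibniz_lie U V W := funext fun γ => leibniz_lie (U γ) (V γ) (W γ)

instance : LieAlgebra ℝ (VectorField I) where
  lie_smul c V W := funext fun γ => lie_smul c (V γ) (W γ)

/-- `(V S)(γ) = V_γ (S(γ))`. -/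
instance : LieRingModule (VectorField I) (Functional I) where
  bracket V S := fun γ => ⁅V γ, S γ⁆
  add_lie U V S := funext fun γ => add_lie (U γ) (V γ) (S γ)
  lie_add U S S' := funext fun γ => lie_add (U γ) (S γ) (S' γ)
  leibniz_lie U V S := funext fun γ => leibniz_lie (U γ) (V γ) (S γ)

instance : LieModule ℝ (VectorField I) (Functional I) where
  smul_lie c V S := funext fun γ => smul_lie c (V γ) (S γ)
  lie_smul c V S := funext fun γ => lie_smul c (V γ) (S γ)

/-- The functional `∫ L ds`. -/
def action (L : ScalarField I) : Functional I := fun γ => integral (L γ)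

/-- The covector field `α_p` on `𝔛_𝒜(Λ₀)`, `α_p(V)(γ) = ∫ V_γ(k) p_γ ds`. -/
def covector : ScalarField I →ₗ[ℝ] (VectorField I →ₗ[ℝ] Functional I) :=
  LinearMap.mk₂ ℝ (fun p V => (fun γ => integral ((V γ).curv * p γ) : Functional I))
    (fun p q V => funext fun γ => by
      change integral _ = integral _ + integral _
      rw [← map_add, ← mul_add]; rfl)
    (fun c p V => funext fun γ => by
      change integral _ = c • integral _
      rw [← map_smul, ← mul_smul_comm]; rfl)
    (fun p V W => funext fun γ => by
      change integral (Tangent.curv (V γ + W γ) * _) = integral _ + integral _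
      rw [← map_add, ← add_mul, map_add])
    (fun c p V => funext fun γ => by
      change integral (Tangent.curv (c • V γ) * _) = c • integral _
      rw [← map_smul, ← smul_mul_assoc, map_smul])

/-- The `p ∈ 𝒜` for which there is `p₁ ∈ 𝒜` with `p₁' = k p'`. -/
def admissible (I : Set ℝ) : Submodule ℝ (ScalarField I) where
  carrier := {p | ∃ p₁ : ScalarField I, ∀ γ, totalD (p₁ γ) = kappa * totalD (p γ)}
  zero_mem' := ⟨0, by simp⟩
  add_mem' := by
    rintro p q ⟨p₁, hp⟩ ⟨q₁, hq⟩
    exact ⟨p₁ + q₁, fun γ => by simp [hp, hq, mul_add]⟩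
  smul_mem' := by
    rintro c p ⟨p₁, hp⟩
    exact ⟨c • p₁, fun γ => by simp [hp]⟩

theorem admissible_apply {p : ScalarField I} (hp : p ∈ admissible I) (γ : Curve I) :
    p γ ∈ domD := by
  obtain ⟨p₁, h⟩ := hp
  exact ⟨p₁ γ, h γ⟩

/-- The space `Ω¹` of the one-forms `α_p` with admissible `p`. -/
def Omega1 (I : Set ℝ) : Submodule ℝ (VectorField I →ₗ[ℝ] Functional I) :=
  (admissible I).map covector

def oneForm (p : ScalarField I) (hp : p ∈ admissible I) : Omega1 I :=
  ⟨covector p, Submodule.mem_map_of_mem hp⟩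

/-- `π̄(α_p)(γ) = Φ_γ⁻¹ (π₁ (α_{p_γ}))` for all `α_p ∈ Ω¹` and all `γ`. -/
def IsPullback (πbar : Omega1 I → VectorField I) : Prop :=
  ∀ (p : ScalarField I) (hp : p ∈ admissible I) (γ : Curve I),
    Phi (πbar (oneForm p hp) γ) = pi1 (mkdvForm (p γ) (admissible_apply hp γ))

/-- The actual vector field `f T + g N` along `γ` given by `V_γ`. -/
def VectorField.along (V : VectorField I) (γ : Curve I) (s : ℝ) : EuclideanSpace ℝ (Fin 2) :=
  γ.evalPoly (V γ).tan s • γ.T s + γ.evalPoly (V γ).nor s • γ.N s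

/-- The family `Γ t`, `t ∈ J`, of curves solves the equation `γ_t = V(γ)`. -/
def IsFlowLine (V : VectorField I) (J : Set ℝ) (Γ : ℝ → Curve I) : Prop :=
  ∀ t ∈ J, ∀ s ∈ I, HasDerivWithinAt (fun τ => (Γ τ).toFun s) (V.along (Γ t) s) J t

/-- The planar filament equation `γ_t = ½ k² T + k' N`. -/
def SolvesPlanarFilament (J : Set ℝ) (Γ : ℝ → Curve I) : Prop :=
  ∀ t ∈ J, ∀ s ∈ I, HasDerivWithinAt (fun τ => (Γ τ).toFun s)
    ((1 / 2 * (Γ t).k s ^ 2) • (Γ t).T s + derivWithin (Γ t).k I s • (Γ t).N s) J t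

/-- The functional `S₀ = ∫ ½ k² ds`. -/
def S0 (I : Set ℝ) : Functional I := action fun _ => C (1 / 2) * kappa ^ 2

end Fields

end PlanarFilament

end

open PlanarFilament MvPolynomial

/-! Everything except the filament equation is algebra in `𝒫`, carried out separately for each
curve. Write `h_p = D_s⁻¹(k p') T + p' N`. Its variation of curvature is `(p'' + k f)' = 𝒟 p` with
`f = D_s⁻¹(k p')`, so `h_p` is a preimage of `π₁(α_p)` under `Φ`. The pulled-back operator must
therefore be `α_p ↦ h_p`.

Injectivity and nondegeneracy rest on one fact (`exists_smul_of_evol_mem`): an evolutionary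
derivation that kills every functional is `c D_s`. Every functional has a variational derivative,
and translation invariance places it in the domain of `𝒟`. So a field `v` annihilated by all `α_p`
has `v(k) = c k'`. Then `(f - c, g)` solves the rotation system `F' = k g`, `g' = -k F`, whose only
polynomial solution is zero. Since `f` has no constant term, `c = 0` and `v = 0`.

The form `α_p` need not determine `p` (constants give zero), but skewness and nondegeneracy together
show that it determines `h_p`; hence the operator is well defined. Skewness and closedness hold
because the relevant expressions are explicit total derivatives, and the bracket of two fields
`h_p`, `h_q` is again some `h_r`. Finally `dS₀ = α_k` and `D_s⁻¹(k k') = ½ k²`. -/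

namespace PlanarFilament

/-! ### Differential polynomials of bounded order -/

theorem mem_supported_of_pderiv_eq_zero {N : ℕ} {r : DiffPoly}
    (hr : r ∈ supported ℝ (Set.Iio (N + 1))) (h : pderiv N r = 0) :
    r ∈ supported ℝ (Set.Iio N) := by
  rw [mem_supported] at hr ⊢
  intro m hm
  have h1 : m < N + 1 := hr hm
  have h2 : m ≠ N := fun e => notMem_vars_of_pderiv_eq_zero h (e ▸ hm)
  exact Set.mem_Iio.2 (by omega)

theorem pderiv_eq_zero_of_mem_supported {N : ℕ} {s : Set ℕ} {r : DiffPoly}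
    (hr : r ∈ supported ℝ s) (hN : N ∉ s) : pderiv N r = 0 :=
  pderiv_eq_zero_of_notMem_vars fun h => hN ((mem_supported.1 hr) h)

theorem pderiv_mem_supported {N : ℕ} {s : Set ℕ} {r : DiffPoly} (hr : r ∈ supported ℝ s) :
    pderiv N r ∈ supported ℝ s := by
  classical
  rw [pderiv_def]
  refine derivation_mem_supported (fun m _ => ?_) hr
  by_cases hm : m = N
  · subst hm; simp
  · simp [hm]

theorem X_mem_supported_Iio {m N : ℕ} (h : m < N) :
    (X m : DiffPoly) ∈ supported ℝ (Set.Iio N) :=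
  Algebra.subset_adjoin ⟨m, h, rfl⟩

theorem supported_Iio_mono {M N : ℕ} (h : M ≤ N) {r : DiffPoly}
    (hr : r ∈ supported ℝ (Set.Iio M)) : r ∈ supported ℝ (Set.Iio N) :=
  supported_mono (Set.Iio_subset_Iio h) hr

theorem exists_mem_supported_Iio (r : DiffPoly) : ∃ N, r ∈ supported ℝ (Set.Iio N) := by
  obtain ⟨N, hN⟩ := r.vars.bddAbove
  refine ⟨N + 1, ?_⟩
  rw [mem_supported]
  intro m hm
  exact Nat.lt_succ_of_le (hN hm)

theorem eq_C_of_mem_supported_Iio_zero {r : DiffPoly} (hr : r ∈ supported ℝ (Set.Iio 0)) :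
    r = C (constantCoeff r) := by
  have h0 : (Set.Iio 0 : Set ℕ) = ∅ := by ext; simp
  rw [h0, supported_empty] at hr
  obtain ⟨c, rfl⟩ := Algebra.mem_bot.1 hr
  simp [algebraMap_eq]

theorem totalD_C (c : ℝ) : totalD (C c) = 0 := totalD.map_algebraMap c

theorem totalD_X (m : ℕ) : totalD (X m) = X (m + 1) := by simp [totalD, mkDerivation_X]

/-- Both sides of `[∂/∂k^{(m+1)}, D_s] = ∂/∂k^{(m)}` are derivations, so generators suffice. This
relation drives all the order counting: the top-order part of `D_s f` is read off from `f`. -/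
theorem pderiv_succ_totalD (m : ℕ) (f : DiffPoly) :
    pderiv (m + 1) (totalD f) = totalD (pderiv (m + 1) f) + pderiv m f := by
  have h : ⁅(pderiv (m + 1) : Derivation ℝ DiffPoly DiffPoly), totalD⁆ = pderiv m := by
    classical
    apply derivation_ext
    intro j
    rw [Derivation.commutator_apply, totalD_X, pderiv_X, pderiv_X, pderiv_X]
    by_cases h1 : j + 1 = m + 1
    · obtain rfl : j = m := by omega
      simp
    · have h2 : j ≠ m := by omega
      by_cases h3 : j = m + 1 <;> simp [h2, h3]
  have h2 := congrArg (fun D => D f) h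
  simp only [Derivation.commutator_apply] at h2
  rw [← h2]; ring

theorem mem_supported_of_totalD_mem_aux {N : ℕ} {r : DiffPoly}
    (hr : r ∈ supported ℝ (Set.Iio (N + 1))) (h : totalD r ∈ supported ℝ (Set.Iio (N + 1))) :
    r ∈ supported ℝ (Set.Iio N) := by
  apply mem_supported_of_pderiv_eq_zero hr
  have h1 := pderiv_succ_totalD N r
  rw [pderiv_eq_zero_of_mem_supported h (by simp),
    pderiv_eq_zero_of_mem_supported hr (by simp)] at h1
  simpa using h1.symm

/-- An antiderivative has lower order. -/
theorem mem_supported_of_totalD_mem {N : ℕ} {r : DiffPoly}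
    (h : totalD r ∈ supported ℝ (Set.Iio (N + 1))) : r ∈ supported ℝ (Set.Iio N) := by
  obtain ⟨M, hM⟩ := exists_mem_supported_Iio r
  induction M with
  | zero => exact supported_Iio_mono (Nat.zero_le N) hM
  | succ M ih =>
    rcases le_or_gt (M + 1) N with h1 | h1
    · exact supported_Iio_mono h1 hM
    · exact ih (mem_supported_of_totalD_mem_aux hM (supported_Iio_mono (by omega) h))

theorem eq_C_of_totalD_eq_zero {r : DiffPoly} (h : totalD r = 0) : r = C (constantCoeff r) :=
  eq_C_of_mem_supported_Iio_zero
    (mem_supported_of_totalD_mem (N := 0) (by rw [h]; exact Subalgebra.zero_mem _))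

theorem eq_of_totalD_eq {f g : DiffPoly} (h : totalD f = totalD g)
    (h0 : constantCoeff f = constantCoeff g) : f = g := by
  have h1 := eq_C_of_totalD_eq_zero (r := f - g) (by rw [map_sub, h, sub_self])
  rw [map_sub, h0, sub_self, C_0] at h1
  exact sub_eq_zero.1 h1

/-! ### The formal antiderivative -/

theorem Dinv_spec {f : DiffPoly} (hf : f ∈ totalDerivs) :
    totalD (Dinv f) = f ∧ constantCoeff (Dinv f) = 0 := by
  obtain ⟨q, hq⟩ := hf
  have h : ∃ q : DiffPoly, totalD q = f ∧ constantCoeff q = 0 := by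
    -- Subtracting the constant term normalizes the antiderivative without changing its derivative.
    refine ⟨q - C (constantCoeff q), ?_, by simp⟩
    rw [map_sub, totalD_C, sub_zero]
    exact hq
  rw [Dinv, dif_pos h]
  exact h.choose_spec

theorem Dinv_eq {f q : DiffPoly} (h : totalD q = f) (h0 : constantCoeff q = 0) : Dinv f = q := by
  obtain ⟨h1, h2⟩ := Dinv_spec (f := f) ⟨q, h⟩
  exact eq_of_totalD_eq (h1.trans h.symm) (h2.trans h0.symm)

/-! ### Functionals, integration by parts and variational derivatives -/

theorem integral_eq_zero_iff {f : DiffPoly} : integral f = 0 ↔ f ∈ totalDerivs :=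
  Submodule.Quotient.mk_eq_zero _

theorem integral_eq_integral_iff {f g : DiffPoly} :
    integral f = integral g ↔ f - g ∈ totalDerivs :=
  Submodule.Quotient.eq _

theorem totalD_mem (f : DiffPoly) : totalD f ∈ totalDerivs := ⟨f, rfl⟩

theorem mul_totalD_mem {f g : DiffPoly} (h : totalD f * g ∈ totalDerivs) :
    f * totalD g ∈ totalDerivs := by
  have h1 := totalDerivs.sub_mem (totalD_mem (f * g)) h
  rw [Derivation.leibniz, smul_eq_mul, smul_eq_mul] at h1
  convert h1 using 1
  ring

theorem exists_iterate_totalD_adjoint (m : ℕ) (g : DiffPoly) :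
    ∃ p, ∀ a, totalD^[m] a * g - a * p ∈ totalDerivs := by
  induction m generalizing g with
  | zero => exact ⟨g, fun a => by simp⟩
  | succ m ih =>
    obtain ⟨p, hp⟩ := ih (-totalD g)
    refine ⟨p, fun a => ?_⟩
    have h := totalDerivs.add_mem (hp a) (totalD_mem (totalD^[m] a * g))
    rw [Derivation.leibniz, smul_eq_mul, smul_eq_mul] at h
    rw [Function.iterate_succ_apply']
    convert h using 1
    ring

/-- The weight `g` is what makes the induction on `L` close: in the product rule the remaining
factor is absorbed into it. The case `g = 1` gives the variational derivative. -/
theorem exists_evol_adjoint (L g : DiffPoly) :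
    ∃ p, ∀ a, evol a L * g - a * p ∈ totalDerivs := by
  induction L using MvPolynomial.induction_on generalizing g with
  | C c => exact ⟨0, fun a => by simp [evol]⟩
  | add L M hL hM =>
    obtain ⟨p, hp⟩ := hL g
    obtain ⟨q, hq⟩ := hM g
    refine ⟨p + q, fun a => ?_⟩
    convert totalDerivs.add_mem (hp a) (hq a) using 1
    rw [map_add]; ring
  | mul_X L m hL =>
    obtain ⟨p, hp⟩ := hL (X m * g)
    obtain ⟨q, hq⟩ := exists_iterate_totalD_adjoint m (L * g)
    refine ⟨p + q, fun a => ?_⟩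
    convert totalDerivs.add_mem (hp a) (hq a) using 1
    rw [Derivation.leibniz, evol_X, smul_eq_mul, smul_eq_mul]; ring

theorem evol_totalD_kappa (f : DiffPoly) : evol (totalD kappa) f = totalD f := by
  have h : evol (totalD kappa) = totalD := by
    apply derivation_ext
    intro m
    rw [evol_X, totalD_X]
    induction m with
    | zero => simp [kappa, totalD_X]
    | succ m ih => rw [Function.iterate_succ_apply', ih, totalD_X]
  rw [h]

/-- Every Lagrangian has a variational derivative, and it lies in the domain of `𝒟`. -/
theorem exists_variational_derivative (L : DiffPoly) :
    ∃ p ∈ domD, ∀ a, integral (evol a L) = integral (a * p) := by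
  obtain ⟨p, hp⟩ := exists_evol_adjoint L 1
  simp only [mul_one] at hp
  refine ⟨p, ?_, fun a => integral_eq_integral_iff.2 (hp a)⟩
  change kappa * totalD p ∈ totalDerivs
  apply mul_totalD_mem
  -- Translation invariance: for `a = k'` the derivation `∂_a` is `D_s`, so `∫ k' p ds = ∫ D_s L ds
  -- = 0`; one integration by parts gives the domain condition.
  have h := totalDerivs.sub_mem (totalD_mem L) (hp (totalD kappa))
  rw [evol_totalD_kappa] at h
  simpa using h

/-! ### Evolutionary derivations that act trivially on functionals -/

theorem totalD_of_mem_supported_one {s : DiffPoly} (hs : s ∈ supported ℝ (Set.Iio 1)) :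
    totalD s = X 1 * pderiv 0 s := by
  have := derivation_eqOn_supported (R := ℝ) (D₁ := totalD)
    (D₂ := (X 1 : DiffPoly) • pderiv 0) (s := Set.Iio 1) (fun m hm => ?_) hs
  · simpa using this
  · obtain rfl : m = 0 := by simpa using hm
    simp [totalD_X]

theorem totalD_of_mem_supported_two {s : DiffPoly} (hs : s ∈ supported ℝ (Set.Iio 2)) :
    totalD s = X 1 * pderiv 0 s + X 2 * pderiv 1 s := by
  have := derivation_eqOn_supported (R := ℝ) (D₁ := totalD)
    (D₂ := (X 1 : DiffPoly) • pderiv 0 + (X 2 : DiffPoly) • pderiv 1) (s := Set.Iio 2)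
    (fun m hm => ?_) hs
  · simpa using this
  · have hm2 : m < 2 := hm
    interval_cases m <;> simp [totalD_X]

/-- Integration by parts: `(s k^{j+1})' = t k^{j+1} + (j+1) s k' k^j`. -/
theorem mul_pow_mem_of_totalD_mul {s t : DiffPoly} (hst : totalD s = t)
    (h : ∀ j : ℕ, t * kappa ^ j ∈ totalDerivs) (j : ℕ) :
    s * X 1 * kappa ^ j ∈ totalDerivs := by
  have h1 := totalDerivs.smul_mem ((j + 1 : ℝ)⁻¹)
    (totalDerivs.sub_mem (totalD_mem (s * kappa ^ (j + 1))) (h (j + 1)))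
  have h0 : (j + 1 : ℝ) ≠ 0 := by positivity
  convert h1 using 1
  rw [eq_inv_smul_iff₀ h0, Derivation.leibniz, Derivation.leibniz_pow, hst]
  simp only [kappa, totalD_X, smul_eq_mul, smul_eq_C_mul, map_add, map_natCast, map_one,
    nsmul_eq_mul, Nat.add_sub_cancel]
  push_cast
  ring

/-- Descent on the order. An antiderivative `t` of `s k'` has lower order and inherits the
hypothesis, so it depends on `k` alone; then `s k' = t' = k' ∂t/∂k` shows the same for `s`. -/
theorem mem_supported_one_of_mul_pow_mem {N : ℕ} {s : DiffPoly}
    (hs : s ∈ supported ℝ (Set.Iio (N + 1)))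
    (h : ∀ j : ℕ, s * X 1 * kappa ^ j ∈ totalDerivs) : s ∈ supported ℝ (Set.Iio 1) := by
  induction N generalizing s with
  | zero => exact hs
  | succ N ih =>
    have h0 : s * X 1 ∈ totalDerivs := by simpa using h 0
    obtain ⟨t, ht⟩ := h0
    change totalD t = s * X 1 at ht
    have h1 : t ∈ supported ℝ (Set.Iio (N + 1)) := by
      apply mem_supported_of_totalD_mem
      rw [ht]
      exact Subalgebra.mul_mem _ hs (X_mem_supported_Iio (by omega))
    have h2 := ih h1 (mul_pow_mem_of_totalD_mul ht h)
    rw [totalD_of_mem_supported_one h2, mul_comm] at ht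
    rw [← mul_right_cancel₀ (X_ne_zero 1) ht]
    exact pderiv_mem_supported h2

/-- An antiderivative `r` would satisfy `∂r/∂k' = G k'` and `∂r/∂k = 0`; equality of mixed partials
forces `∂G/∂k = 0`. -/
theorem eq_C_of_mul_mem {G : DiffPoly} (hG : G ∈ supported ℝ (Set.Iio 1))
    (h : G * X 1 * X 2 ∈ totalDerivs) : G = C (constantCoeff G) := by
  obtain ⟨r, hr⟩ := h
  change totalD r = G * X 1 * X 2 at hr
  have hr2 : r ∈ supported ℝ (Set.Iio 2) := by
    apply mem_supported_of_totalD_mem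
    rw [hr]
    exact Subalgebra.mul_mem _ (Subalgebra.mul_mem _ (supported_Iio_mono (by omega) hG)
      (X_mem_supported_Iio (by omega))) (X_mem_supported_Iio (by omega))
  have h1 := pderiv_succ_totalD 1 r
  rw [pderiv_eq_zero_of_mem_supported hr2 (by simp), hr, map_zero, zero_add] at h1
  have h2 : pderiv (1 + 1) (G * X 1 * X 2) = G * X 1 := by
    have : pderiv 2 G = 0 := pderiv_eq_zero_of_mem_supported hG (by simp)
    simp [Derivation.leibniz, this, pderiv_X]
  rw [h2] at h1
  have h3 : pderiv 0 r = 0 := by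
    -- In `r' = k' ∂r/∂k + k'' ∂r/∂k'` the second term already equals `G k' k''`.
    rw [totalD_of_mem_supported_two hr2, ← h1] at hr
    have h4 : X 1 * pderiv 0 r = 0 := by linear_combination hr
    exact (mul_eq_zero.1 h4).resolve_left (X_ne_zero 1)
  have h4 : pderiv 0 (pderiv 1 r) = pderiv 1 (pderiv 0 r) := by
    have h : ⁅(pderiv 0 : Derivation ℝ DiffPoly DiffPoly),
        (pderiv 1 : Derivation ℝ DiffPoly DiffPoly)⁆ = 0 := by
      classical
      apply derivation_ext
      intro j
      simp only [Derivation.commutator_apply, pderiv_X, Pi.single_apply]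
      split_ifs <;> simp
    have h2 := congrArg (fun D => D r) h
    simpa [Derivation.commutator_apply, sub_eq_zero] using h2
  rw [h3, map_zero, ← h1, Derivation.leibniz] at h4
  have h5 : pderiv 0 G = 0 := by
    have h6 : X 1 * pderiv 0 G = 0 := by simpa [pderiv_X] using h4
    exact (mul_eq_zero.1 h6).resolve_left (X_ne_zero 1)
  exact eq_C_of_mem_supported_Iio_zero (mem_supported_of_pderiv_eq_zero hG h5)

/-- Only the multiples of `∂_{k'} = D_s` act trivially on `𝒫 / Im ∂`. -/
theorem exists_smul_of_evol_mem {a : DiffPoly} (h : ∀ L, evol a L ∈ totalDerivs) :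
    ∃ c : ℝ, a = c • totalD kappa := by
  -- Testing on the Lagrangians `k^{j+1}` will force `a = G(k) k'`; testing on `k'^2` below then
  -- makes `G` constant.
  have h1 : ∀ j : ℕ, a * kappa ^ j ∈ totalDerivs := by
    intro j
    have h2 := totalDerivs.smul_mem ((j + 1 : ℝ)⁻¹) (h (kappa ^ (j + 1)))
    have h0 : (j + 1 : ℝ) ≠ 0 := by positivity
    convert h2 using 1
    rw [eq_inv_smul_iff₀ h0, Derivation.leibniz_pow, evol_kappa]
    simp only [smul_eq_mul, smul_eq_C_mul, map_add, map_natCast, map_one,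
      nsmul_eq_mul, Nat.add_sub_cancel]
    push_cast
    ring
  obtain ⟨s, hs⟩ : a ∈ totalDerivs := by simpa using h1 0
  change totalD s = a at hs
  obtain ⟨N, hN⟩ := exists_mem_supported_Iio s
  have hs1 : s ∈ supported ℝ (Set.Iio 1) :=
    mem_supported_one_of_mul_pow_mem (supported_Iio_mono (Nat.le_succ N) hN)
      (mul_pow_mem_of_totalD_mul hs h1)
  have hG := pderiv_mem_supported (N := 0) hs1
  have ha : a = pderiv 0 s * X 1 := by rw [← hs, totalD_of_mem_supported_one hs1, mul_comm]
  have h2 : a * X 2 ∈ totalDerivs := by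
    rw [← totalD_X 1]
    apply mul_totalD_mem
    have h3 := totalDerivs.smul_mem (2⁻¹ : ℝ) (h (X 1 ^ 2))
    convert h3 using 1
    rw [eq_inv_smul_iff₀ two_ne_zero, Derivation.leibniz_pow, evol_X]
    simp only [smul_eq_mul, smul_eq_C_mul, nsmul_eq_mul, map_ofNat, Function.iterate_one]
    push_cast
    ring
  rw [ha] at h2
  refine ⟨constantCoeff (pderiv 0 s), ?_⟩
  rw [← C_mul', ← eq_C_of_mul_mem hG h2, ha, kappa, totalD_X]

/-! ### Tangent fields -/

/-- Each of `f`, `g` is an antiderivative of `k` times the other up to sign, so any common bound on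
their orders can be lowered until both are constants. -/
theorem eq_zero_of_rotation {f g : DiffPoly} (hf : totalD f = kappa * g)
    (hg : totalD g = -(kappa * f)) : f = 0 ∧ g = 0 := by
  have hk : kappa ≠ 0 := X_ne_zero 0
  have key : ∀ N, f ∈ supported ℝ (Set.Iio N) → g ∈ supported ℝ (Set.Iio N) →
      f = 0 ∧ g = 0 := by
    intro N
    induction N with
    | zero =>
      intro h1 h2
      rw [eq_C_of_mem_supported_Iio_zero h1, totalD_C, zero_eq_mul] at hf
      rw [eq_C_of_mem_supported_Iio_zero h2, totalD_C, zero_eq_neg, mul_eq_zero] at hg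
      exact ⟨hg.resolve_left hk, hf.resolve_left hk⟩
    | succ N ih =>
      intro h1 h2
      have hk : kappa ∈ supported ℝ (Set.Iio (N + 1)) := X_mem_supported_Iio (Nat.succ_pos N)
      refine ih (mem_supported_of_totalD_mem ?_) (mem_supported_of_totalD_mem ?_)
      · rw [hf]; exact Subalgebra.mul_mem _ hk h2
      · rw [hg]; exact Subalgebra.neg_mem _ (Subalgebra.mul_mem _ hk h1)
  obtain ⟨M, hM⟩ := exists_mem_supported_Iio f
  obtain ⟨N, hN⟩ := exists_mem_supported_Iio g
  exact key (max M N) (supported_Iio_mono (le_max_left M N) hM)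
    (supported_Iio_mono (le_max_right M N) hN)

namespace Tangent

theorem eq_zero_of_curv_eq_smul {v : Tangent} {c : ℝ} (h : v.curv = c • totalD kappa) :
    v = 0 := by
  have h1 : v.phi = c • kappa := by
    apply eq_of_totalD_eq
    · rw [Derivation.map_smul, ← h, curv_apply]
    · rw [constantCoeff_phi]
      simp [kappa, smul_eq_C_mul]
  rw [phi_apply, ← C_mul'] at h1
  -- With `φ_v = g' + k f = c k`, shifting `f` by `c` gives the homogeneous rotation system; the
  -- normalization of `f` then rules out `c ≠ 0`.
  obtain ⟨h2, h3⟩ := eq_zero_of_rotation (f := v.tan - C c) (g := v.nor)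
    (by rw [map_sub, totalD_C, sub_zero, totalD_tan]) (by linear_combination h1)
  have h4 := congrArg constantCoeff h2
  rw [map_sub, constantCoeff_tan, constantCoeff_C, zero_sub, map_zero, neg_eq_zero] at h4
  rw [h4, C_0, sub_zero] at h2
  ext1
  · rw [h2, map_zero]
  · rw [h3, map_zero]

/-- Tangent fields are separated by the covectors `α_p` with `p` in the domain of `𝒟`. -/
theorem eq_zero_of_integral_eq_zero {v : Tangent}
    (h : ∀ p ∈ domD, integral (v.curv * p) = 0) : v = 0 := by
  obtain ⟨c, hc⟩ := exists_smul_of_evol_mem (a := v.curv) fun L => by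
    obtain ⟨p, hp, hpL⟩ := exists_variational_derivative L
    rw [← integral_eq_zero_iff, hpL, h p hp]
  exact eq_zero_of_curv_eq_smul hc

end Tangent

theorem partialD_eq_iff {a b : DiffPoly} : partialD a = partialD b ↔ a = b := by
  refine ⟨fun h => ?_, fun h => h ▸ rfl⟩
  have h1 := congrArg (fun ξ : derStar => (ξ : Derivation ℝ DiffPoly DiffPoly) kappa) h
  simpa only [partialD_apply, evol_kappa] using h1

theorem Phi_injective : Function.Injective Phi := by
  rw [injective_iff_map_eq_zero]
  intro v hv
  have h : v.curv = 0 := partialD_eq_iff.1 (hv.trans (map_zero _).symm)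
  exact Tangent.eq_zero_of_curv_eq_smul (c := 0) (by rw [h, zero_smul])

/-! ### The Hamiltonian field of a differential polynomial -/

/-- The field `D_s⁻¹ (k p') T + p' N`. -/
noncomputable def hamField (p : domD) : Tangent :=
  (⟨(Dinv (kappa * totalD p.1), totalD p.1), Dinv_spec p.2⟩ : tangentSubmodule)

theorem hamField_tan (p : domD) : (hamField p).tan = Dinv (kappa * totalD p.1) := rfl

theorem hamField_nor (p : domD) : (hamField p).nor = totalD p.1 := rfl

theorem Tangent.ext_nor {v w : Tangent} (h : v.nor = w.nor) : v = w :=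
  Tangent.ext (eq_of_totalD_eq (by rw [v.totalD_tan, w.totalD_tan, h])
    (by rw [v.constantCoeff_tan, w.constantCoeff_tan])) h

theorem Phi_hamField (p : domD) : Phi (hamField p) = partialD (opD p.1) := by
  refine partialD_eq_iff.2 ?_
  rw [Tangent.curv_apply, Tangent.phi_apply, hamField_nor, map_add, Derivation.leibniz,
    Tangent.totalD_tan, hamField_nor, hamField_tan, opD, smul_eq_mul, smul_eq_mul]
  ring

/-! ### Skewness, brackets and closedness for the fields `h_p` -/

theorem hamField_skew (p q : domD) :
    integral ((hamField p).curv * q.1) = -integral ((hamField q).curv * p.1) := by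
  rw [← map_neg, integral_eq_integral_iff]
  have h1 := (hamField p).totalD_tan
  have h2 := (hamField q).totalD_tan
  rw [Tangent.curv_apply, Tangent.curv_apply, Tangent.phi_apply, Tangent.phi_apply]
  rw [hamField_nor] at *
  set f := (hamField p).tan
  set g := (hamField q).tan
  -- The boundary terms `φ_p q + φ_q p - p' q' - f g` collected when integrating by parts.
  refine ⟨(totalD (totalD p.1) + kappa * f) * q.1 + (totalD (totalD q.1) + kappa * g) * p.1
    - totalD p.1 * totalD q.1 - f * g, ?_⟩
  change totalD _ = _
  simp only [map_add, map_sub, Derivation.leibniz, smul_eq_mul, h1, h2, hamField_nor]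
  ring

/-- The new polynomial is `r = h_p(q) - h_q(p) + f_q p' - f_p q'`. Only normal components need
comparison, and `k r'` is exact because it is the derivative of the tangential component of the
bracket. -/
theorem lie_hamField (p q : domD) : ∃ r : domD, ⁅hamField p, hamField q⁆ = hamField r := by
  have h : totalD (Tangent.der (hamField p) q.1 - Tangent.der (hamField q) p.1
      + (hamField q).tan * totalD p.1 - (hamField p).tan * totalD q.1) =
      Tangent.nor ⁅hamField p, hamField q⁆ := by
    rw [Tangent.lie_nor, Tangent.phi_apply, Tangent.phi_apply, hamField_nor, hamField_nor,
      Tangent.der_totalD, Tangent.der_totalD, map_sub, map_add, map_sub, Derivation.leibniz,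
      Derivation.leibniz, Tangent.totalD_tan, Tangent.totalD_tan, hamField_nor, hamField_nor]
    simp only [smul_eq_mul]
    ring
  have hr : Tangent.der (hamField p) q.1 - Tangent.der (hamField q) p.1
      + (hamField q).tan * totalD p.1 - (hamField p).tan * totalD q.1 ∈ domD := by
    change kappa * totalD _ ∈ totalDerivs
    rw [h, ← Tangent.totalD_tan]
    exact totalD_mem _
  refine ⟨⟨_, hr⟩, Tangent.ext_nor ?_⟩
  rw [hamField_nor]
  exact h.symm

/-- Skewness of `𝒟` combined with its variation along `v`. Since `v(p)` need not lie in the domain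
of `𝒟`, the polynomial `v(f_p)` replaces the missing antiderivative; the last summand is the
contribution of varying `k` in `𝒟`. -/
theorem mul_der_curv_add_mem (v : Tangent) (p r : domD) :
    r.1 * Tangent.der v (hamField p).curv + (hamField r).curv * Tangent.der v p.1
      + v.curv * (totalD r.1 * (hamField p).tan - (hamField r).tan * totalD p.1)
      ∈ totalDerivs := by
  have hf := (hamField p).totalD_tan
  have hh := (hamField r).totalD_tan
  rw [Tangent.curv_apply, Tangent.curv_apply, Tangent.phi_apply, Tangent.phi_apply]
  rw [hamField_nor] at *
  have hm : totalD (Tangent.der v (hamField p).tan) = Tangent.der v (kappa * totalD p.1) := by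
    rw [← Tangent.der_totalD, hf]
  set f := (hamField p).tan
  set h := (hamField r).tan
  set P := Tangent.der v p.1 with hP
  set m := Tangent.der v f with hmdef
  have hk : Tangent.der v kappa = v.curv := Tangent.der_kappa v
  rw [Derivation.leibniz, smul_eq_mul, smul_eq_mul, hk, Tangent.der_totalD, ← hP] at hm
  refine ⟨r.1 * (totalD (totalD P) + v.curv * f + kappa * m) - totalD r.1 * totalD P
    + totalD (totalD r.1) * P - h * m + h * kappa * P, ?_⟩
  change totalD _ = _
  simp only [map_add, map_sub, Derivation.leibniz, smul_eq_mul, hf, hh, hm, Tangent.der_totalD,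
    ← hP, ← hmdef, hk, hamField_nor]
  ring

/-- The antiderivative is the determinant with rows `(φ_p, p', f_p)`, and likewise for `q`, `r`.
Differentiating its second or third column contributes nothing, since `p'' = φ_p - k f_p` and `f_p'
= k p'`. -/
theorem cyclic_mem (p q r : domD) :
    (hamField p).curv * (totalD q.1 * (hamField r).tan - (hamField q).tan * totalD r.1)
    + (hamField q).curv * (totalD r.1 * (hamField p).tan - (hamField r).tan * totalD p.1)
    + (hamField r).curv * (totalD p.1 * (hamField q).tan - (hamField p).tan * totalD q.1)
      ∈ totalDerivs := by
  have h1 := (hamField p).totalD_tan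
  have h2 := (hamField q).totalD_tan
  have h3 := (hamField r).totalD_tan
  rw [Tangent.curv_apply, Tangent.curv_apply, Tangent.curv_apply]
  have e1 := (hamField p).phi_apply
  have e2 := (hamField q).phi_apply
  have e3 := (hamField r).phi_apply
  rw [hamField_nor] at *
  refine ⟨(hamField p).phi * (totalD q.1 * (hamField r).tan - (hamField q).tan * totalD r.1)
    + (hamField q).phi * (totalD r.1 * (hamField p).tan - (hamField r).tan * totalD p.1)
    + (hamField r).phi * (totalD p.1 * (hamField q).tan - (hamField p).tan * totalD q.1), ?_⟩
  change totalD _ = _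
  simp only [map_add, map_sub, Derivation.leibniz, smul_eq_mul, h1, h2, h3]
  rw [e1, e2, e3]
  ring

theorem act_sub_integral_lie (v w : Tangent) (p : DiffPoly) :
    ⁅v, integral (w.curv * p)⁆ - integral (Tangent.curv ⁅v, w⁆ * p) =
      integral (w.curv * Tangent.der v p + p * Tangent.der w v.curv) := by
  change Tangent.act _ _ - _ = _
  rw [Tangent.act_integral, ← map_sub, Tangent.curv_lie, Derivation.leibniz]
  congr 1
  simp only [smul_eq_mul]
  ring

theorem hamField_closed (p q r : domD) :
    (⁅hamField p, integral ((hamField q).curv * r.1)⁆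
        - integral (Tangent.curv ⁅hamField p, hamField q⁆ * r.1))
      + (⁅hamField q, integral ((hamField r).curv * p.1)⁆
        - integral (Tangent.curv ⁅hamField q, hamField r⁆ * p.1))
      + (⁅hamField r, integral ((hamField p).curv * q.1)⁆
        - integral (Tangent.curv ⁅hamField r, hamField p⁆ * q.1)) = 0 := by
  rw [act_sub_integral_lie, act_sub_integral_lie, act_sub_integral_lie, ← map_add, ← map_add,
    integral_eq_zero_iff]
  -- The six terms are regrouped by the field that differentiates; each pair is exact up to one
  -- summand of the cyclic sum.
  have h := totalDerivs.sub_mem (totalDerivs.add_mem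
    (totalDerivs.add_mem (mul_der_curv_add_mem (hamField q) p r)
      (mul_der_curv_add_mem (hamField r) q p)) (mul_der_curv_add_mem (hamField p) r q))
    (cyclic_mem p q r)
  convert h using 1
  ring

/-! ### The pull-back operator -/

section Fields

variable {I : Set ℝ}

theorem mem_admissible_iff {p : ScalarField I} : p ∈ admissible I ↔ ∀ γ, p γ ∈ domD := by
  refine ⟨fun hp γ => admissible_apply hp γ, fun h => ?_⟩
  choose p₁ hp₁ using h
  exact ⟨p₁, hp₁⟩

theorem covector_apply (p : ScalarField I) (V : VectorField I) (γ : Curve I) :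
    covector p V γ = integral ((V γ).curv * p γ) := rfl

/-- `γ ↦ D_s⁻¹ (k p_γ') T + p_γ' N` as a linear function of `p`. -/
noncomputable def hamVectorField : admissible I →ₗ[ℝ] VectorField I where
  toFun p := fun γ => hamField ⟨p.1 γ, admissible_apply p.2 γ⟩
  map_add' p q := funext fun γ => Tangent.ext_nor <| by
    change totalD (p.1 γ + q.1 γ) = Tangent.nor (hamField _ + hamField _)
    rw [map_add, map_add, hamField_nor, hamField_nor]
  map_smul' c p := funext fun γ => Tangent.ext_nor <| by
    change totalD (c • p.1 γ) = Tangent.nor (c • hamField _)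
    rw [Derivation.map_smul, map_smul, hamField_nor]

theorem hamVectorField_apply (p : admissible I) (γ : Curve I) :
    hamVectorField p γ = hamField ⟨p.1 γ, admissible_apply p.2 γ⟩ := rfl

/-- Well-definedness on one-forms: by skewness `∫ h_p(k) q ds = -∫ h_q(k) p ds = 0` for all `q` in
the domain of `𝒟`, and such covectors separate fields. -/
theorem hamVectorField_eq_zero {p : admissible I} (h : covector p.1 = 0) :
    hamVectorField p = 0 := by
  funext γ
  refine Tangent.eq_zero_of_integral_eq_zero fun q hq => ?_
  rw [hamVectorField_apply, hamField_skew _ ⟨q, hq⟩, neg_eq_zero]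
  exact congrFun (LinearMap.congr_fun h fun _ => hamField ⟨q, hq⟩) γ

/-- The map `p ↦ α_p` onto the one-forms. -/
noncomputable def toOneForm : admissible I →ₗ[ℝ] Omega1 I := covector.submoduleMap (admissible I)

theorem toOneForm_surjective : Function.Surjective (toOneForm (I := I)) :=
  LinearMap.submoduleMap_surjective _ _

theorem toOneForm_apply (p : admissible I) : toOneForm p = oneForm p.1 p.2 := rfl

theorem exists_pullback :
    ∃ π : Omega1 I →ₗ[ℝ] VectorField I, ∀ p, π (toOneForm p) = hamVectorField p := by
  have hker : LinearMap.ker (toOneForm (I := I)) ≤ LinearMap.ker hamVectorField := by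
    intro p hp
    exact hamVectorField_eq_zero (congrArg Subtype.val hp)
  -- The linear map descends to the quotient by the kernel of `p ↦ α_p`, which is identified with
  -- `Ω¹`.
  refine ⟨(LinearMap.ker toOneForm).liftQ hamVectorField hker ∘ₗ
    (toOneForm.quotKerEquivOfSurjective toOneForm_surjective).symm.toLinearMap, fun p => ?_⟩
  have h : (toOneForm.quotKerEquivOfSurjective toOneForm_surjective).symm (toOneForm p) =
      (LinearMap.ker toOneForm).mkQ p := by
    rw [LinearEquiv.symm_apply_eq]; rfl
  simp only [LinearMap.comp_apply, LinearEquiv.coe_coe, h]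
  rfl

theorem isHamiltonianOperator_of_apply {π : Omega1 I →ₗ[ℝ] VectorField I}
    (h : ∀ p, π (toOneForm p) = hamVectorField p) : IsHamiltonianOperator (Omega1 I) π where
  skew α β := by
    obtain ⟨p, rfl⟩ := toOneForm_surjective α
    obtain ⟨q, rfl⟩ := toOneForm_surjective β
    rw [h, h]
    funext γ
    exact hamField_skew ⟨p.1 γ, admissible_apply p.2 γ⟩ ⟨q.1 γ, admissible_apply q.2 γ⟩
  range_lie α β := by
    obtain ⟨p, rfl⟩ := toOneForm_surjective α
    obtain ⟨q, rfl⟩ := toOneForm_surjective β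
    choose r hr using fun γ => lie_hamField ⟨p.1 γ, admissible_apply p.2 γ⟩
      ⟨q.1 γ, admissible_apply q.2 γ⟩
    refine ⟨toOneForm ⟨fun γ => (r γ).1, mem_admissible_iff.2 fun γ => (r γ).2⟩, ?_⟩
    rw [h, h, h]
    exact funext fun γ => (hr γ).symm
  closed α β δ := by
    obtain ⟨p, rfl⟩ := toOneForm_surjective α
    obtain ⟨q, rfl⟩ := toOneForm_surjective β
    obtain ⟨r, rfl⟩ := toOneForm_surjective δ
    rw [h, h, h]
    funext γ
    exact hamField_closed ⟨p.1 γ, admissible_apply p.2 γ⟩ ⟨q.1 γ, admissible_apply q.2 γ⟩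
      ⟨r.1 γ, admissible_apply r.2 γ⟩

theorem isPullback_of_apply {π : Omega1 I →ₗ[ℝ] VectorField I}
    (h : ∀ p, π (toOneForm p) = hamVectorField p) : IsPullback π := by
  intro p hp γ
  rw [pi1_mkdvForm, ← toOneForm_apply ⟨p, hp⟩, h, hamVectorField_apply, Phi_hamField]

theorem IsPullback.eq {π π' : Omega1 I → VectorField I} (h : IsPullback π)
    (h' : IsPullback π') : π = π' := by
  funext α γ
  obtain ⟨p, rfl⟩ := toOneForm_surjective α
  exact Phi_injective ((h p.1 p.2 γ).trans (h' p.1 p.2 γ).symm)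

theorem isOneFormSpace_Omega1 : IsOneFormSpace (Omega1 I) where
  exists_vector α _ hα := by
    by_contra! h
    exact hα (LinearMap.ext h)
  exists_form ξ hξ := by
    by_contra! h
    refine hξ (funext fun γ => Tangent.eq_zero_of_integral_eq_zero fun p hp => ?_)
    exact congrFun (h _ (oneForm (fun _ => p) (mem_admissible_iff.2 fun _ => hp)).2) γ
  differential_mem F := by
    choose L hL using fun γ => totalDerivs.mkQ_surjective (F γ)
    choose p hp hpL using fun γ => exists_variational_derivative (L γ)
    refine ⟨p, mem_admissible_iff.2 hp, LinearMap.ext fun V => funext fun γ => ?_⟩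
    change _ = Tangent.act (V γ) (F γ)
    rw [covector_apply, ← hpL, ← hL]
    rfl

/-! ### The functional `∫ ½ k² ds` -/

theorem derivation_half_kappa_sq (D : Derivation ℝ DiffPoly DiffPoly) :
    D (C (1 / 2) * kappa ^ 2) = kappa * D kappa := by
  have h : (C (1 / 2) * 2 : DiffPoly) = 1 := by
    rw [← map_ofNat C 2, ← C_mul]; norm_num
  rw [C_mul', D.map_smul, Derivation.leibniz_pow, ← C_mul']
  simp only [smul_eq_mul, nsmul_eq_mul, Nat.add_one_sub_one, pow_one]
  push_cast
  linear_combination kappa * D kappa * h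

theorem totalD_half_kappa_sq : totalD (C (1 / 2) * kappa ^ 2) = kappa * totalD kappa :=
  derivation_half_kappa_sq totalD

theorem kappa_mem_admissible : (fun _ => kappa) ∈ admissible I :=
  ⟨fun _ => C (1 / 2) * kappa ^ 2, fun _ => totalD_half_kappa_sq⟩

theorem differential_S0 :
    differential (S0 I) = (oneForm (fun _ => kappa) kappa_mem_admissible).1 := by
  refine LinearMap.ext fun V => funext fun γ => ?_
  change integral (Tangent.der (V γ) (C (1 / 2) * kappa ^ 2)) = integral ((V γ).curv * kappa)
  rw [Tangent.der, derivation_half_kappa_sq, evol_kappa, mul_comm]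

end Fields

end PlanarFilament

/-! ### Assembly of the theorem -/

theorem mainTheorem4 (I : Set ℝ) (hI : I.OrdConnected) (hI' : I.Nontrivial) :
    Function.Injective Phi ∧
    IsOneFormSpace (Omega1 I) ∧
    ∃ πbar : Omega1 I →ₗ[ℝ] VectorField I,
      IsPullback πbar ∧
      (∀ π' : Omega1 I → VectorField I, IsPullback π' → π' = πbar) ∧
      IsHamiltonianOperator (Omega1 I) πbar ∧
      (∀ (p : ScalarField I) (hp : p ∈ admissible I) (γ : Curve I),
        (πbar (oneForm p hp) γ).tan = Dinv (kappa * totalD (p γ)) ∧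
        (πbar (oneForm p hp) γ).nor = totalD (p γ)) ∧
      ∃ hS : differential (S0 I) ∈ Omega1 I,
        (∀ γ : Curve I,
          (πbar ⟨differential (S0 I), hS⟩ γ).tan = C (1 / 2) * kappa ^ 2 ∧
          (πbar ⟨differential (S0 I), hS⟩ γ).nor = totalD kappa) ∧
        ∀ (J : Set ℝ) (Γ : ℝ → Curve I),
          IsFlowLine (πbar ⟨differential (S0 I), hS⟩) J Γ ↔ SolvesPlanarFilament J Γ := by
  obtain ⟨π, hπ⟩ := exists_pullback (I := I)
  have hpb := isPullback_of_apply hπ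
  have hexpl : ∀ (p : ScalarField I) (hp : p ∈ admissible I) (γ : Curve I),
      (π (oneForm p hp) γ).tan = Dinv (kappa * totalD (p γ)) ∧
      (π (oneForm p hp) γ).nor = totalD (p γ) := fun p hp γ => by
    rw [← toOneForm_apply ⟨p, hp⟩, hπ]
    exact ⟨rfl, rfl⟩
  have hS : differential (S0 I) ∈ Omega1 I := isOneFormSpace_Omega1.differential_mem _
  have hdS : (⟨differential (S0 I), hS⟩ : Omega1 I) =
      oneForm (fun _ => kappa) kappa_mem_admissible := Subtype.ext differential_S0
  have hfil : ∀ γ : Curve I,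
      (π ⟨differential (S0 I), hS⟩ γ).tan = C (1 / 2) * kappa ^ 2 ∧
      (π ⟨differential (S0 I), hS⟩ γ).nor = totalD kappa := fun γ => by
    rw [hdS]
    -- Since `½ k²` has no constant term, it is the normalized antiderivative of `k k'`.
    refine ⟨(hexpl _ _ γ).1.trans (Dinv_eq totalD_half_kappa_sq ?_), (hexpl _ _ γ).2⟩
    simp [kappa]
  refine ⟨Phi_injective, isOneFormSpace_Omega1, π, hpb, fun π' h => h.eq hpb,
    isHamiltonianOperator_of_apply hπ, hexpl, hS, hfil, fun J Γ => ?_⟩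
  have halong : ∀ (γ : Curve I) (s : ℝ), VectorField.along (π ⟨differential (S0 I), hS⟩) γ s =
      (1 / 2 * γ.k s ^ 2) • γ.T s + derivWithin γ.k I s • γ.N s := fun γ s => by
    rw [VectorField.along, (hfil γ).1, (hfil γ).2, kappa, totalD_X]
    simp [Curve.evalPoly, iteratedDerivWithin_one]
  simp only [IsFlowLine, SolvesPlanarFilament, halong]
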